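/- Let $N\ge 1$, $\Omega_1=\{x\in\mathbb R^N: x_N>0\}$, $\Omega_2=\{x\in\mathbb R^N: x_N<0\}$, $\mathcal H=\{x\in\mathbb R^N: x_N=0\}$ and $e_N=(0,\dots,0,1)$. For $i=1,2$ let $A_i$ be a non-empty compact metric space, let $b_i:\mathbb R^N\times A_i\to\mathbb R^N$ be continuous and bounded, and suppose there is $L_i\in\mathbb R$ with $|b_i(x,\alpha_i)-b_i(y,\alpha_i)|\le L_i|x-y|$ for all $x,y\in\mathbb R^N$, $\alpha_i\in A_i$. Let $l_i:\mathbb R^N\times A_i\to\mathbb R$ be continuous and bounded, and suppose that for each $x\in\mathbb R^N$ the set $\{(b_i(x,\alpha_i),l_i(x,\alpha_i)):\alpha_i\in A_i\}$ is closed and convex $(i=1,2)$. Put $B_i(x)=\{b_i(x,\alpha_i):\alpha_i\in A_i\}$ and $$\mathcal B(x)=\begin{cases}B_1(x)&\text{if }x_N>0,\\ B_2(x)&\text{if }x_N<0,\\ \overline{\mathrm{co}}\,(B_1(x)\cup B_2(x))&\text{if }x_N=0,\end{cases}$$ where $\overline{\mathrm{co}}$ denotes the closed convex hull. For $x_0\in\mathbb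 R^N$, a solution of the differential inclusion starting from $x_0$ is a Lipschitz function $X:[0,\infty)\to\mathbb R^N$ with $$X(0)=x_0,\qquad \dot X(t)\in\mathcal B(X(t))\ \text{ for a.e. } t\in(0,\infty). \tag{1}$$ Let $A=A_1\times A_2\times[0,1]$, $\mathcal A=L^\infty(0,\infty;A)$ and, for $a=(\alpha_1,\alpha_2,\mu)\in A$, $b_{\mathcal H}(x,a)=\mu\, b_1(x,\alpha_1)+(1-\mu)\,b_2(x,\alpha_2)$. Then: (i) For each $x_0\in\mathbb R^N$ there exists a Lipschitz function $X:[0,\infty)\to\mathbb R^N$ which is a solution of (1). (ii) For each $x_0\in\mathbb R^N$ and each solution $X$ of (1) there exists a control $a(\cdot)=(\alpha_1(\cdot),\alpha_2(\cdot),\mu(\cdot))\in\mathcal A$ such that, for a.e. $t>0$, $$\dot X(t)=b_1(X(t),\alpha_1(t))\mathbf 1_{\{X(t)\in\Omega_1\}}+b_2(X(t),\alpha_2(t))\mathbf 1_{\{X(t)\in\Omega_2\}}+b_{\mathcal H}(X(t),a(t))\mathbf 1_{\{X(t)\in\mathcal H\}}. \tag{2}$$ (iii) For each solution $X$ of (1)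 and each control $a(\cdot)\in\mathcal A$ such that (2) holds for a.e. $t>0$, $$b_{\mathcal H}(X(t),a(t))\cdot e_N=0\quad\text{for a.e. } t>0 \text{ with } X_N(t)=0.$$ -/

import Mathlib

namespace TwoDomain

open MeasureTheory Set

/-- The Euclidean space `ℝ^N` with `N = n + 1 ≥ 1`. -/
abbrev Space (n : ℕ) : Type := EuclideanSpace ℝ (Fin (n + 1))

/-- The last vector `e_N = (0, …, 0, 1)` of the canonical basis. -/
noncomputable def eN (n : ℕ) : Space n := EuclideanSpace.single (Fin.last n) (1 : ℝ)

/-- `Ω₁ = {x_N > 0}`. -/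
def Omega₁ (n : ℕ) : Set (Space n) := {x | 0 < x (Fin.last n)}

/-- `Ω₂ = {x_N < 0}`. -/
def Omega₂ (n : ℕ) : Set (Space n) := {x | x (Fin.last n) < 0}

/-- The hyperplane `H = {x_N = 0}`. -/
def Hyper (n : ℕ) : Set (Space n) := {x | x (Fin.last n) = 0}

/-- The hypothesis on one dynamic `b : ℝ^N × A → ℝ^N`: jointly continuous, bounded, and Lipschitz
in `x` uniformly with respect to the control. -/
structure LipschitzDynamic {n : ℕ} {A : Type*} [TopologicalSpace A]
    (b : Space n → A → Space n) : Prop where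
  continuous : Continuous fun p : Space n × A => b p.1 p.2
  bounded : ∃ M : ℝ, ∀ x α, ‖b x α‖ ≤ M
  lipschitz : ∃ L : ℝ, ∀ x y α, ‖b x α - b y α‖ ≤ L * ‖x - y‖

/-- The hypothesis on one running cost `l : ℝ^N × A → ℝ`: jointly continuous and bounded. -/
structure BoundedCost {n : ℕ} {A : Type*} [TopologicalSpace A]
    (l : Space n → A → ℝ) : Prop where
  continuous : Continuous fun p : Space n × A => l p.1 p.2
  bounded : ∃ M : ℝ, ∀ x α, |l x α| ≤ M

/-- The convexity hypothesis (without controllability): for every `x`, the set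
`{(b(x, α), l(x, α)) : α ∈ A}` is closed and convex. -/
def ClosedConvexImages {n : ℕ} {A : Type*}
    (b : Space n → A → Space n) (l : Space n → A → ℝ) : Prop :=
  ∀ x, IsClosed (range fun α => (b x α, l x α)) ∧
    Convex ℝ (range fun α => (b x α, l x α))

section Dynamics

variable {n : ℕ} {A₁ A₂ : Type*}

open Classical in
/-- The set-valued field `𝓑`: it is `B₁(x) = {b₁(x, α₁)}` on `Ω₁`, `B₂(x) = {b₂(x, α₂)}` on `Ω₂`
and the closed convex hull of `B₁(x) ∪ B₂(x)` on `H`. -/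
noncomputable def field (b₁ : Space n → A₁ → Space n) (b₂ : Space n → A₂ → Space n)
    (x : Space n) : Set (Space n) :=
  if x ∈ Omega₁ n then range (b₁ x)
  else if x ∈ Omega₂ n then range (b₂ x)
  else closure (convexHull ℝ (range (b₁ x) ∪ range (b₂ x)))

/-- `X` is a Lipschitz solution on `[0, ∞)` of `Ẋ(t) ∈ 𝓑(X(t))` for a.e. `t > 0`, `X(0) = x₀`.
Only the values of `X` on `[0, ∞)` matter. -/
structure IsTrajectory (b₁ : Space n → A₁ → Space n) (b₂ : Space n → A₂ → Space n)
    (x₀ : Space n) (X : ℝ → Space n) : Prop where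
  lipschitz : ∃ K : NNReal, LipschitzOnWith K X (Ici 0)
  initial : X 0 = x₀
  inclusion : ∀ᵐ t ∂(volume.restrict (Ioi (0 : ℝ))),
    ∃ v ∈ field b₁ b₂ (X t), HasDerivAt X v t

/-- The control set `A = A₁ × A₂ × [0, 1]`. -/
abbrev ControlSet (A₁ A₂ : Type*) : Type _ := A₁ × A₂ × unitInterval

/-- `a` represents an element of `L^∞(0, ∞; A)`: it is Lebesgue measurable on `(0, ∞)`;
boundedness is automatic since `A` is compact. -/
def IsControl [MeasurableSpace A₁] [MeasurableSpace A₂] (a : ℝ → ControlSet A₁ A₂) : Prop :=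
  AEMeasurable a (volume.restrict (Ioi (0 : ℝ)))

/-- `b_H(x, (α₁, α₂, μ)) = μ b₁(x, α₁) + (1 - μ) b₂(x, α₂)`. -/
noncomputable def bH (b₁ : Space n → A₁ → Space n) (b₂ : Space n → A₂ → Space n)
    (x : Space n) (a : ControlSet A₁ A₂) : Space n :=
  (a.2.2 : ℝ) • b₁ x a.1 + (1 - (a.2.2 : ℝ)) • b₂ x a.2.1

/-- For a.e. `t > 0`, `X` is differentiable at `t` and
`Ẋ = b₁(X, α₁) 1_{X ∈ Ω₁} + b₂(X, α₂) 1_{X ∈ Ω₂} + b_H(X, a) 1_{X ∈ H}` at `t`. -/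
def IsGeneratedBy (b₁ : Space n → A₁ → Space n) (b₂ : Space n → A₂ → Space n)
    (X : ℝ → Space n) (a : ℝ → ControlSet A₁ A₂) : Prop :=
  ∀ᵐ t ∂(volume.restrict (Ioi (0 : ℝ))),
    HasDerivAt X
      ({s | X s ∈ Omega₁ n}.indicator (fun s => b₁ (X s) (a s).1) t
        + {s | X s ∈ Omega₂ n}.indicator (fun s => b₂ (X s) (a s).2.1) t
        + {s | X s ∈ Hyper n}.indicator (fun s => bH b₁ b₂ (X s) (a s)) t) t

end Dynamics

end TwoDomain

open MeasureTheory Set Filter Topology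
open scoped NNReal

/-! For existence, freeze one control on each side and blend the two Lipschitz fields by `switch`
across a layer of width 1/k around the hyperplane. The resulting curves are equi-Lipschitz. Limit
velocities stay in the inclusion because its values are closed and convex and, near any point x, the
blended fields lie almost in the value at x (`exists_switch_mem_field`,
`exists_solution_of_approximation`). For controls, every velocity on the hyperplane is some `bH`, by
convexity and compactness, so Filippov's lemma (`exists_measurable_implicit_selection`) chooses the
controls measurably. For tangency, the N-th component of the velocity is the derivative of X_N,
which vanishes almost everywhere on the zero set of X_N. -/

namespace TwoDomain

/-! ### Differential inclusions as limits of Lipschitz equations -/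

section Existence

variable {E : Type*} [NormedAddCommGroup E] [NormedSpace ℝ E] [CompleteSpace E]

/-- A bounded Lipschitz vector field has, for every `T`, an integral curve on `(0, T)`, which extends
to a globally Lipschitz curve. -/
theorem exists_integralCurve_of_bounded {f : E → E} {K M : ℝ≥0} (hf : LipschitzWith K f)
    (hM : ∀ x, ‖f x‖ ≤ M) (T : ℝ≥0) (x₀ : E) :
    ∃ X : ℝ → E, LipschitzWith M X ∧ X 0 = x₀ ∧
      ∀ t ∈ Ioo (0 : ℝ) T, HasDerivAt X (f (X t)) t := by
  have hT : (0 : ℝ) ≤ T := T.2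
  have hpl : IsPicardLindelof (fun _ : ℝ => f) (⟨0, le_rfl, hT⟩ : Icc (0 : ℝ) T) x₀ (M * T) 0 M K :=
    IsPicardLindelof.of_time_independent (fun x _ => hM x) hf.lipschitzOnWith (by simp)
  obtain ⟨α, hα0, hα⟩ := hpl.exists_eq_forall_mem_Icc_hasDerivWithinAt₀
  have hlip : LipschitzOnWith M α (Icc (0 : ℝ) T) :=
    (convex_Icc _ _).lipschitzOnWith_of_nnnorm_hasDerivWithin_le hα
      fun t _ => by exact_mod_cast hM (α t)
  have heq : ∀ t ∈ Icc (0 : ℝ) T, α (projIcc (0 : ℝ) T hT t) = α t := fun t ht => by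
    rw [projIcc_of_mem hT ht]
  -- Holding the curve constant outside [0, T] keeps the Lipschitz constant M and can spoil the
  -- derivative only at the endpoints.
  refine ⟨fun t => α (projIcc (0 : ℝ) T hT t), ?_, ?_, fun t ht => ?_⟩
  · have := hlip.to_restrict.comp (LipschitzWith.projIcc hT)
    rwa [mul_one] at this
  · exact (heq 0 ⟨le_rfl, hT⟩).trans hα0
  · have hnhds : Icc (0 : ℝ) T ∈ 𝓝 t := Icc_mem_nhds ht.1 ht.2
    have ht' := Ioo_subset_Icc_self ht
    simp only [heq t ht']
    exact ((hα t ht').hasDerivAt hnhds).congr_of_eventuallyEq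
      (Filter.mem_of_superset hnhds heq)

/-- If the velocity of a curve stays in a closed convex set, then so do its mean velocities. -/
theorem mean_velocity_mem {C : Set E} (hC : IsClosed C) (hconv : Convex ℝ C) {X : ℝ → E} {f : E → E}
    (hf : Continuous f) (hX : Continuous X) {s t : ℝ} (hst : s < t)
    (hd : ∀ r ∈ Ioo s t, HasDerivAt X (f (X r)) r) (hmem : ∀ r ∈ Icc s t, f (X r) ∈ C) :
    (t - s)⁻¹ • (X t - X s) ∈ C := by
  have hcont : Continuous fun r => f (X r) := hf.comp hX
  rw [← intervalIntegral.integral_eq_sub_of_hasDerivAt_of_le hst.le hX.continuousOn hd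
    (hcont.intervalIntegrable _ _), ← interval_average_eq, uIoc_of_le hst.le]
  refine hconv.set_average_mem hC ?_ ?_ ?_ ?_
  · simpa using hst
  · simp
  · exact (ae_restrict_iff' measurableSet_Ioc).2 (.of_forall fun r hr =>
      hmem r (Ioc_subset_Icc_self hr))
  · exact (hcont.integrableOn_Icc).mono_set Ioc_subset_Icc_self

/-- Existence for a differential inclusion `X' ∈ F X` whose right-hand side has closed convex values:
it suffices that equibounded Lipschitz fields `f k` satisfy `f k y ∈ F x` up to a small error, for
`y` near `x` and `k` large. -/
theorem exists_solution_of_approximation [FiniteDimensional ℝ E] {F : E → Set E}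
    (hFc : ∀ x, IsClosed (F x)) (hFconv : ∀ x, Convex ℝ (F x)) {f : ℕ → E → E} {M : ℝ≥0}
    (hfL : ∀ k, ∃ K, LipschitzWith K (f k)) (hfM : ∀ k x, ‖f k x‖ ≤ M)
    (happ : ∀ x, ∀ δ > 0, ∃ η > 0, ∀ᶠ k in atTop, ∀ y, dist y x < η →
      f k y ∈ Metric.cthickening δ (F x)) (x₀ : E) :
    ∃ X : ℝ → E, LipschitzWith M X ∧ X 0 = x₀ ∧
      ∀ᵐ t ∂(volume.restrict (Ioi (0 : ℝ))), ∃ v ∈ F (X t), HasDerivAt X v t := by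
  choose K hK using hfL
  choose Y hYL hY0 hYd using fun k : ℕ => exists_integralCurve_of_bounded (hK k) (hfM k) k x₀
  -- Pointwise limits along one ultrafilter replace Arzelà–Ascoli: no subsequence is needed, and the
  -- Lipschitz bound passes to the limit.
  have hlim : ∀ t, ∃ z, Tendsto (fun k => Y k t) (hyperfilter ℕ) (𝓝 z) := fun t => by
    have hmem : ∀ k, Y k t ∈ Metric.closedBall x₀ (M * dist t 0) := fun k => by
      simpa [hY0] using (hYL k).dist_le_mul t 0
    obtain ⟨z, -, hz⟩ := (isCompact_closedBall x₀ (M * dist t 0)).ultrafilter_le_nhds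
      ((hyperfilter ℕ).map fun k => Y k t) (by
        rw [le_principal_iff]; exact Filter.mem_map.2 (Filter.univ_mem' hmem))
    exact ⟨z, hz⟩
  choose X hX using hlim
  have hXL : LipschitzWith M X := LipschitzWith.of_dist_le_mul fun s t =>
    le_of_tendsto ((hX s).dist (hX t)) (.of_forall fun k => (hYL k).dist_le_mul s t)
  refine ⟨X, hXL, ?_, ?_⟩
  · exact tendsto_nhds_unique (hX 0) (by simp [hY0])
  filter_upwards [ae_restrict_of_ae hXL.ae_differentiableAt_real, ae_restrict_mem measurableSet_Ioi]
    with t htd ht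
  refine ⟨deriv X t, ?_, htd.hasDerivAt⟩
  rw [← (hFc (X t)).closure_eq, Metric.closure_eq_iInter_cthickening, mem_iInter₂]
  intro δ hδ
  obtain ⟨η, hη, hev⟩ := happ (X t) δ hδ
  have hslope : Tendsto (fun s => (s - t)⁻¹ • (X s - X t)) (𝓝[>] t) (𝓝 (deriv X t)) :=
    (hasDerivAt_iff_tendsto_slope.1 htd.hasDerivAt).mono_left
      (nhdsWithin_mono _ fun s hs => ne_of_gt hs)
  refine Metric.isClosed_cthickening.mem_of_tendsto hslope ?_
  -- During a time r after t, `Y k` moves less than η/2; the other η/2 covers its distance from X t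
  -- at time t.
  obtain ⟨r, hr, hrη⟩ : ∃ r > 0, M * r < η / 2 :=
    ⟨η / 2 / (M + 1), by positivity, by
      rw [mul_div_assoc', div_lt_iff₀ (by positivity)]; nlinarith [M.2]⟩
  filter_upwards [Ioo_mem_nhdsGT (show t < t + r by linarith)] with s hs
  refine Metric.isClosed_cthickening.mem_of_tendsto
    ((((hX s).sub (hX t)).const_smul (s - t)⁻¹)) ?_
  have hhyp : ((hyperfilter ℕ : Ultrafilter ℕ) : Filter ℕ) ≤ atTop :=
    Nat.cofinite_eq_atTop ▸ hyperfilter_le_cofinite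
  filter_upwards [hhyp hev, hhyp (eventually_ge_atTop ⌈s⌉₊),
    (Metric.tendsto_nhds.1 (hX t)) (η / 2) (by positivity)] with k hk hks hkt
  have hsk : s ≤ k := (Nat.le_ceil s).trans (by exact_mod_cast hks)
  -- The slope of X is a limit of slopes of `Y k`, which are mean velocities; k ≥ s ensures that `Y
  -- k` solves its equation on (t, s).
  refine mean_velocity_mem Metric.isClosed_cthickening ((hFconv _).cthickening δ)
    (hK k).continuous (hYL k).continuous hs.1
    (fun q hq => hYd k q ⟨lt_trans ht hq.1, hq.2.trans_le (by simpa using hsk)⟩)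
    fun q hq => hk _ ?_
  have h1 : dist (Y k q) (Y k t) ≤ M * dist q t := (hYL k).dist_le_mul q t
  have h2 : dist q t ≤ r := by
    rw [Real.dist_eq, abs_of_nonneg (by linarith [hq.1])]; linarith [hq.2, hs.2]
  have h3 : (M : ℝ) * dist q t ≤ M * r := by gcongr
  linarith [dist_triangle (Y k q) (Y k t) (X t)]

end Existence

/-! ### Measurable selections and Filippov's lemma -/

section MeasurableSelection

variable {Ω : Type*} [MeasurableSpace Ω] {A : Type*} [MetricSpace A] [CompactSpace A]

/-- A multifunction with nonempty closed values in a compact metric space, whose hitting sets of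
closed sets are measurable, has a measurable selection. -/
theorem exists_measurable_selection [Nonempty A] [MeasurableSpace A] [BorelSpace A] {R : Ω → Set A}
    (hne : ∀ ω, (R ω).Nonempty) (hcl : ∀ ω, IsClosed (R ω))
    (hmeas : ∀ C : Set A, IsClosed C → MeasurableSet {ω | (R ω ∩ C).Nonempty}) :
    ∃ a : Ω → A, Measurable a ∧ ∀ ω, a ω ∈ R ω := by
  obtain ⟨g, hg, hgs⟩ := exists_nat_bool_continuous_surjective_of_compact A
  have : CompactSpace cantorSet := isCompact_iff_compactSpace.1 isCompact_cantorSet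
  let p : cantorSet → A := g ∘ cantorSetHomeomorphNatToBool
  have hp : Continuous p := hg.comp cantorSetHomeomorphNatToBool.continuous
  have hps : Function.Surjective p := hgs.comp cantorSetHomeomorphNatToBool.surjective
  -- Lift to the Cantor set, whose linear order allows a canonical choice: the least point of the
  -- preimage.
  have hmin : ∀ ω, ∃ c ∈ p ⁻¹' R ω, IsMinOn id (p ⁻¹' R ω) c := fun ω =>
    ((hcl ω).preimage hp).isCompact.exists_isMinOn
      ((hne ω).preimage hps) continuous_id.continuousOn
  choose c hcR hcmin using hmin
  have hc : Measurable fun ω => (c ω : ℝ) := measurable_of_Iic fun q => by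
    have hset : (fun ω => (c ω : ℝ)) ⁻¹' Iic q = {ω | (R ω ∩ p '' {x | (x : ℝ) ≤ q}).Nonempty} := by
      ext ω
      constructor
      · exact fun h => ⟨p (c ω), hcR ω, c ω, h, rfl⟩
      · rintro ⟨_, hR, x, hx, rfl⟩
        exact (show (c ω : ℝ) ≤ x from hcmin ω hR).trans hx
    rw [hset]
    exact hmeas _ ((isClosed_le continuous_subtype_val continuous_const).isCompact.image hp).isClosed
  exact ⟨fun ω => p (c ω), hp.measurable.comp (hc.subtype_mk (h := fun ω => (c ω).2)), hcR⟩

/-- The hitting sets of an implicitly defined multifunction. -/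
theorem measurableSet_exists_eq {E : Type*} [MetricSpace E] [SecondCountableTopology E]
    [MeasurableSpace E] [BorelSpace E] {g : Ω → A → E} {y : Ω → E}
    (hgm : ∀ α, Measurable fun ω => g ω α) (hgc : ∀ ω, Continuous (g ω)) (hy : Measurable y)
    {C : Set A} (hC : IsClosed C) : MeasurableSet {ω | ∃ α ∈ C, g ω α = y ω} := by
  obtain ⟨D, hDC, hDcount, hCD⟩ := (TopologicalSpace.IsSeparable.of_separableSpace C).exists_countable_dense_subset
  have hset : {ω | ∃ α ∈ C, g ω α = y ω}
      = ⋂ k : ℕ, ⋃ d ∈ D, {ω | dist (g ω d) (y ω) < 1 / (k + 1 : ℝ)} := by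
    ext ω
    have hcont : Continuous fun α => dist (g ω α) (y ω) := (hgc ω).dist continuous_const
    simp only [mem_ofPred_eq, mem_iInter, mem_iUnion, exists_prop]
    constructor
    · rintro ⟨α, hα, he⟩ k
      have hU : IsOpen {β | dist (g ω β) (y ω) < 1 / (k + 1 : ℝ)} :=
        isOpen_lt hcont continuous_const
      obtain ⟨d, hd, hdD⟩ := mem_closure_iff.1 (hCD hα) _ hU (by
        simp only [mem_ofPred_eq, he, dist_self]; positivity)
      exact ⟨d, hdD, hd⟩
    · intro h
      have hne : C.Nonempty := let ⟨d, hd, _⟩ := h 0; ⟨d, hDC hd⟩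
      -- Compactness turns arbitrarily good approximate solutions into an exact one: the minimal
      -- distance is zero.
      obtain ⟨α, hα, hmin⟩ := hC.isCompact.exists_isMinOn hne hcont.continuousOn
      refine ⟨α, hα, dist_le_zero.1 (le_of_forall_pos_le_add fun ε hε => ?_)⟩
      obtain ⟨k, hk⟩ := exists_nat_one_div_lt hε
      obtain ⟨d, hd, hlt⟩ := h k
      have := hmin (hDC hd)
      simp only [mem_ofPred_eq] at this
      linarith
  rw [hset]
  exact .iInter fun k => .biUnion hDcount fun d _ =>
    measurableSet_lt ((hgm d).dist hy) measurable_const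

/-- **Filippov's lemma**: an equation `g ω α = y ω` can be solved measurably for `α`, at those `ω`
where it is solvable. -/
theorem exists_measurable_implicit_selection [Nonempty A] [MeasurableSpace A] [BorelSpace A]
    {E : Type*} [MetricSpace E] [SecondCountableTopology E]
    [MeasurableSpace E] [BorelSpace E] {g : Ω → A → E} {y : Ω → E}
    (hgm : ∀ α, Measurable fun ω => g ω α) (hgc : ∀ ω, Continuous (g ω)) (hy : Measurable y) :
    ∃ a : Ω → A, Measurable a ∧ ∀ ω, (∃ α, g ω α = y ω) → g ω (a ω) = y ω := by
  -- Where the equation has no solution, `R ω` is all of A, so that the multifunction never has an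
  -- empty value.
  let R : Ω → Set A := fun ω => {α | (∃ β, g ω β = y ω) → g ω α = y ω}
  have hpos : ∀ ω, (∃ β, g ω β = y ω) → R ω = {α | g ω α = y ω} := fun ω h => by
    ext α; exact ⟨fun hα => hα h, fun hα _ => hα⟩
  have hneg : ∀ ω, (¬ ∃ β, g ω β = y ω) → R ω = univ := fun ω h =>
    eq_univ_of_forall fun α h' => absurd h' h
  refine exists_measurable_selection (R := R) (fun ω => ?_) (fun ω => ?_) fun C hC => ?_
  · by_cases h : ∃ β, g ω β = y ω
    · rw [hpos ω h]; exact h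
    · rw [hneg ω h]; exact univ_nonempty
  · by_cases h : ∃ β, g ω β = y ω
    · rw [hpos ω h]; exact isClosed_eq (hgc ω) continuous_const
    · rw [hneg ω h]; exact isClosed_univ
  · rcases C.eq_empty_or_nonempty with rfl | hCne
    · simp
    convert (measurableSet_exists_eq hgm hgc hy hC).union
      (measurableSet_exists_eq hgm hgc hy isClosed_univ).compl using 1
    ext ω
    by_cases h : ∃ β, g ω β = y ω
    · simp only [mem_ofPred_eq, hpos ω h, mem_union, mem_compl_iff, mem_univ, true_and, h,
        not_true, or_false]
      exact exists_congr fun α => and_comm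
    · simp [hneg ω h, h, hCne]

end MeasurableSelection

/-! ### Derivatives on zero sets, Lipschitz blends -/

/-- The derivative of a function vanishes at almost every point of its zero set at which it
exists. -/
theorem ae_eq_zero_of_hasDerivAt_of_eq_zero {f : ℝ → ℝ} :
    ∀ᵐ t : ℝ, f t = 0 → ∀ v, HasDerivAt f v t → v = 0 := by
  -- Zeros isolated from the right are countably many; at any other zero the slope vanishes along
  -- nearby zeros.
  have hcount := (countable_setOfPred_isolated_right_within (s := {t | f t = 0})).ae_notMem volume
  filter_upwards [hcount] with t ht h0 v hv
  have hne : (𝓝[{t | f t = 0} ∩ Ioi t] t).NeBot := ⟨fun h => ht ⟨h0, h⟩⟩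
  have hlim := (hasDerivAt_iff_tendsto_slope.1 hv).mono_left
    (nhdsWithin_mono t (show {t | f t = 0} ∩ Ioi t ⊆ {t}ᶜ from fun s hs => ne_of_gt hs.2))
  refine tendsto_nhds_unique hlim (tendsto_const_nhds.congr' ?_)
  filter_upwards [self_mem_nhdsWithin] with s hs
  simp [slope, h0, show f s = 0 from hs.1]

/-- A Lipschitz convex combination of two bounded Lipschitz fields is Lipschitz. -/
theorem lipschitzWith_convexCombination {E F : Type*} [PseudoMetricSpace E] [NormedAddCommGroup F]
    [NormedSpace ℝ F] {f₁ f₂ : E → F} {c : E → ℝ} {K₁ K₂ κ M : ℝ≥0} (h₁ : LipschitzWith K₁ f₁)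
    (h₂ : LipschitzWith K₂ f₂) (hc : LipschitzWith κ c) (hc01 : ∀ x, c x ∈ Icc (0 : ℝ) 1)
    (hM₁ : ∀ x, ‖f₁ x‖ ≤ M) (hM₂ : ∀ x, ‖f₂ x‖ ≤ M) :
    LipschitzWith (K₁ + K₂ + κ * (2 * M)) fun x => c x • f₁ x + (1 - c x) • f₂ x := by
  refine LipschitzWith.of_dist_le_mul fun x y => ?_
  have hdec : c x • f₁ x + (1 - c x) • f₂ x - (c y • f₁ y + (1 - c y) • f₂ y)
      = c x • (f₁ x - f₁ y) + (1 - c x) • (f₂ x - f₂ y) + (c x - c y) • (f₁ y - f₂ y) := by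
    module
  have e₁ : ‖f₁ x - f₁ y‖ ≤ K₁ * dist x y := dist_eq_norm (f₁ x) (f₁ y) ▸ h₁.dist_le_mul x y
  have e₂ : ‖f₂ x - f₂ y‖ ≤ K₂ * dist x y := dist_eq_norm (f₂ x) (f₂ y) ▸ h₂.dist_le_mul x y
  have e₃ : ‖c x - c y‖ ≤ κ * dist x y := dist_eq_norm (c x) (c y) ▸ hc.dist_le_mul x y
  have e₄ : ‖f₁ y - f₂ y‖ ≤ 2 * M := by
    linarith [norm_sub_le (f₁ y) (f₂ y), hM₁ y, hM₂ y]
  obtain ⟨hc0, hc1⟩ := hc01 x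
  have n₁ : ‖c x • (f₁ x - f₁ y)‖ ≤ K₁ * dist x y := by
    rw [norm_smul, Real.norm_of_nonneg hc0]
    exact (mul_le_of_le_one_left (norm_nonneg _) hc1).trans e₁
  have n₂ : ‖(1 - c x) • (f₂ x - f₂ y)‖ ≤ K₂ * dist x y := by
    rw [norm_smul, Real.norm_of_nonneg (by linarith)]
    exact (mul_le_of_le_one_left (norm_nonneg _) (by linarith)).trans e₂
  have n₃ : ‖(c x - c y) • (f₁ y - f₂ y)‖ ≤ κ * dist x y * (2 * M) := by
    rw [norm_smul]; gcongr
  rw [dist_eq_norm, hdec]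
  push_cast
  linarith [norm_add₃_le (a := c x • (f₁ x - f₁ y)) (b := (1 - c x) • (f₂ x - f₂ y))
    (c := (c x - c y) • (f₁ y - f₂ y))]

theorem ClosedConvexImages.convex_range {n : ℕ} {A : Type*} {b : Space n → A → Space n}
    {l : Space n → A → ℝ} (hc : ClosedConvexImages b l) (x : Space n) : Convex ℝ (range (b x)) := by
  have := (hc x).2.linear_image (LinearMap.fst ℝ (Space n) ℝ)
  rwa [← range_comp] at this

section Dynamic

variable {n : ℕ} {A : Type*} [TopologicalSpace A] {b : Space n → A → Space n}

theorem LipschitzDynamic.exists_lipschitzWith (hb : LipschitzDynamic b) (α : A) :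
    ∃ K, LipschitzWith K fun x => b x α := by
  obtain ⟨L, hL⟩ := hb.lipschitz
  refine ⟨L.toNNReal, LipschitzWith.of_dist_le_mul fun x y => ?_⟩
  rw [dist_eq_norm, dist_eq_norm]
  exact (hL x y α).trans (by gcongr; exact Real.le_coe_toNNReal L)

theorem LipschitzDynamic.continuous_control (hb : LipschitzDynamic b) (x : Space n) :
    Continuous (b x) :=
  hb.continuous.comp (Continuous.prodMk_right x)

theorem LipschitzDynamic.isCompact_range [CompactSpace A] (hb : LipschitzDynamic b) (x : Space n) :
    IsCompact (range (b x)) :=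
  _root_.isCompact_range (hb.continuous_control x)

end Dynamic

/-! ### The set-valued field -/

variable {n : ℕ} {A₁ A₂ : Type*}

section Field

variable {b₁ : Space n → A₁ → Space n} {b₂ : Space n → A₂ → Space n} {x : Space n}

theorem field_of_pos (hx : 0 < x (Fin.last n)) : field b₁ b₂ x = range (b₁ x) :=
  if_pos hx

theorem field_of_neg (hx : x (Fin.last n) < 0) : field b₁ b₂ x = range (b₂ x) :=
  (if_neg (not_lt_of_gt hx)).trans (if_pos hx)

theorem field_of_eq_zero (hx : x (Fin.last n) = 0) :
    field b₁ b₂ x = closure (convexHull ℝ (range (b₁ x) ∪ range (b₂ x))) :=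
  (if_neg (fun h : 0 < x (Fin.last n) => h.ne' hx)).trans
    (if_neg (fun h : x (Fin.last n) < 0 => h.ne hx))

theorem convex_field {l₁ : Space n → A₁ → ℝ} {l₂ : Space n → A₂ → ℝ}
    (hc₁ : ClosedConvexImages b₁ l₁) (hc₂ : ClosedConvexImages b₂ l₂) (x : Space n) :
    Convex ℝ (field b₁ b₂ x) := by
  rcases lt_trichotomy (x (Fin.last n)) 0 with h | h | h
  · rw [field_of_neg h]; exact hc₂.convex_range x
  · rw [field_of_eq_zero h]; exact (convex_convexHull ℝ _).closure
  · rw [field_of_pos h]; exact hc₁.convex_range x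

variable [TopologicalSpace A₁] [TopologicalSpace A₂]

theorem continuous_bH (hb₁ : LipschitzDynamic b₁) (hb₂ : LipschitzDynamic b₂) :
    Continuous fun p : Space n × ControlSet A₁ A₂ => bH b₁ b₂ p.1 p.2 := by
  have h₁ : Continuous fun p : Space n × ControlSet A₁ A₂ => b₁ p.1 p.2.1 :=
    hb₁.continuous.comp (by fun_prop : Continuous fun p : Space n × ControlSet A₁ A₂ => (p.1, p.2.1))
  have h₂ : Continuous fun p : Space n × ControlSet A₁ A₂ => b₂ p.1 p.2.2.1 :=
    hb₂.continuous.comp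
      (by fun_prop : Continuous fun p : Space n × ControlSet A₁ A₂ => (p.1, p.2.2.1))
  have hμ : Continuous fun p : Space n × ControlSet A₁ A₂ => (p.2.2.2 : ℝ) := by fun_prop
  exact (hμ.smul h₁).add ((continuous_const.sub hμ).smul h₂)

variable [CompactSpace A₁] [CompactSpace A₂]

theorem isClosed_field (hb₁ : LipschitzDynamic b₁) (hb₂ : LipschitzDynamic b₂) (x : Space n) :
    IsClosed (field b₁ b₂ x) := by
  rcases lt_trichotomy (x (Fin.last n)) 0 with h | h | h
  · rw [field_of_neg h]; exact (hb₂.isCompact_range x).isClosed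
  · rw [field_of_eq_zero h]; exact isClosed_closure
  · rw [field_of_pos h]; exact (hb₁.isCompact_range x).isClosed

/-- On the hyperplane, every admissible velocity is of the form `b_H(x, a)`. -/
theorem field_subset_range_bH [Nonempty A₁] [Nonempty A₂]
    {l₁ : Space n → A₁ → ℝ} {l₂ : Space n → A₂ → ℝ}
    (hb₁ : LipschitzDynamic b₁) (hb₂ : LipschitzDynamic b₂)
    (hc₁ : ClosedConvexImages b₁ l₁) (hc₂ : ClosedConvexImages b₂ l₂)
    (hx : x (Fin.last n) = 0) : field b₁ b₂ x ⊆ range (bH b₁ b₂ x) := by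
  have hclosed : IsClosed (range (bH b₁ b₂ x)) :=
    (_root_.isCompact_range ((continuous_bH hb₁ hb₂).comp (Continuous.prodMk_right x))).isClosed
  rw [field_of_eq_zero hx]
  refine closure_minimal ?_ hclosed
  -- The hull of two convex sets is a union of segments joining them, so one weight μ suffices.
  rw [(hc₁.convex_range x).convexHull_union (hc₂.convex_range x) (range_nonempty _)
    (range_nonempty _)]
  rintro v hv
  obtain ⟨_, ⟨α₁, rfl⟩, _, ⟨α₂, rfl⟩, μ, ν, hμ, hν, hμν, rfl⟩ := mem_convexJoin.1 hv
  refine ⟨(α₁, α₂, ⟨μ, hμ, by linarith⟩), ?_⟩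
  simp [bH, ← hμν]

end Field

/-! ### Switching and existence of trajectories -/

/-- The continuous switch between the two half-spaces: it vanishes for `x_N ≤ -1/(2k)` and equals
`1` for `x_N ≥ 1/(2k)`. -/
noncomputable def switch (n k : ℕ) (x : Space n) : ℝ :=
  max 0 (min 1 (k * x (Fin.last n) + 1 / 2))

theorem switch_mem_Icc (k : ℕ) (x : Space n) : switch n k x ∈ Icc (0 : ℝ) 1 :=
  ⟨le_max_left _ _, max_le zero_le_one (min_le_left _ _)⟩

theorem lipschitzWith_switch (n k : ℕ) : LipschitzWith k (switch n k) := by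
  have hcoord : LipschitzWith k fun x : Space n => (k : ℝ) * x (Fin.last n) + 1 / 2 :=
    LipschitzWith.of_dist_le_mul fun x y => by
      have := PiLp.norm_apply_le (x - y) (Fin.last n)
      rw [Real.dist_eq, dist_eq_norm,
        show (k : ℝ) * x (Fin.last n) + 1 / 2 - (k * y (Fin.last n) + 1 / 2)
          = k * (x - y) (Fin.last n) by simp; ring, abs_mul, Nat.abs_cast]
      exact mul_le_mul_of_nonneg_left this (Nat.cast_nonneg k)
  exact (hcoord.const_min 1).const_max 0

theorem switch_eq_one {k : ℕ} {x : Space n} (h : 1 / 2 ≤ k * x (Fin.last n)) :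
    switch n k x = 1 := by
  rw [switch, min_eq_left (by linarith), max_eq_right zero_le_one]

theorem switch_eq_zero {k : ℕ} {x : Space n} (h : k * x (Fin.last n) ≤ -(1 / 2)) :
    switch n k x = 0 := by
  rw [switch]
  exact max_eq_left ((min_le_right _ _).trans (by linarith))

/-- Near a given point and for large `k`, the switched combinations of two admissible velocities
frozen at that point are admissible. -/
theorem exists_switch_mem_field {b₁ : Space n → A₁ → Space n} {b₂ : Space n → A₂ → Space n}
    (α₁ : A₁) (α₂ : A₂) (x : Space n) :
    ∃ η > 0, ∀ᶠ k in atTop, ∀ y, dist y x < η →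
      switch n k y • b₁ x α₁ + (1 - switch n k y) • b₂ x α₂ ∈ field b₁ b₂ x := by
  have hcoord : ∀ y, |y (Fin.last n) - x (Fin.last n)| ≤ dist y x := fun y =>
    dist_eq_norm y x ▸ PiLp.norm_apply_le (y - x) (Fin.last n)
  rcases lt_trichotomy (x (Fin.last n)) 0 with h | h | h
  · refine ⟨-x (Fin.last n) / 2, by linarith, ?_⟩
    filter_upwards [eventually_ge_atTop ⌈1 / -x (Fin.last n)⌉₊] with k hk y hy
    -- Here k |x_N| ≥ 1, while y_N ≤ x_N / 2 by the choice of radius, so k y_N ≤ -1/2.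
    have hk' := (div_le_iff₀ (by linarith)).1 ((Nat.le_ceil _).trans (Nat.cast_le.2 hk))
    rw [switch_eq_zero, field_of_neg h]
    · exact ⟨α₂, by simp⟩
    · have := (abs_le.1 (hcoord y)).2
      nlinarith [(Nat.cast_nonneg k : (0 : ℝ) ≤ k)]
  · refine ⟨1, one_pos, .of_forall fun k y _ => ?_⟩
    obtain ⟨h0, h1⟩ := switch_mem_Icc k y
    rw [field_of_eq_zero h]
    exact subset_closure (convex_convexHull ℝ _
      (subset_convexHull ℝ _ (.inl ⟨α₁, rfl⟩)) (subset_convexHull ℝ _ (.inr ⟨α₂, rfl⟩))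
      h0 (by linarith) (by ring))
  · refine ⟨x (Fin.last n) / 2, by linarith, ?_⟩
    filter_upwards [eventually_ge_atTop ⌈1 / x (Fin.last n)⌉₊] with k hk y hy
    have hk' := (div_le_iff₀ h).1 ((Nat.le_ceil _).trans (Nat.cast_le.2 hk))
    rw [switch_eq_one, field_of_pos h]
    · exact ⟨α₁, by simp⟩
    · have := (abs_le.1 (hcoord y)).1
      nlinarith [(Nat.cast_nonneg k : (0 : ℝ) ≤ k)]

theorem exists_isTrajectory [TopologicalSpace A₁] [CompactSpace A₁] [Nonempty A₁]
    [TopologicalSpace A₂] [CompactSpace A₂] [Nonempty A₂]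
    {b₁ : Space n → A₁ → Space n} {b₂ : Space n → A₂ → Space n}
    {l₁ : Space n → A₁ → ℝ} {l₂ : Space n → A₂ → ℝ}
    (hb₁ : LipschitzDynamic b₁) (hb₂ : LipschitzDynamic b₂)
    (hc₁ : ClosedConvexImages b₁ l₁) (hc₂ : ClosedConvexImages b₂ l₂) (x₀ : Space n) :
    ∃ X, IsTrajectory b₁ b₂ x₀ X := by
  obtain ⟨α₁⟩ := ‹Nonempty A₁›
  obtain ⟨α₂⟩ := ‹Nonempty A₂›
  obtain ⟨K₁, hK₁⟩ := hb₁.exists_lipschitzWith α₁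
  obtain ⟨K₂, hK₂⟩ := hb₂.exists_lipschitzWith α₂
  obtain ⟨M₁, hM₁⟩ := hb₁.bounded
  obtain ⟨M₂, hM₂⟩ := hb₂.bounded
  let M : ℝ≥0 := (max M₁ M₂).toNNReal
  have hM : max M₁ M₂ ≤ M := Real.le_coe_toNNReal _
  have hM₁' : ∀ x, ‖b₁ x α₁‖ ≤ M := fun x => (hM₁ x α₁).trans ((le_max_left _ _).trans hM)
  have hM₂' : ∀ x, ‖b₂ x α₂‖ ≤ M := fun x => (hM₂ x α₂).trans ((le_max_right _ _).trans hM)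
  have hdist : ∀ (k : ℕ) (y v₁ v₂ w₁ w₂ : Space n) (r₁ r₂ : ℝ), ‖v₁ - w₁‖ ≤ r₁ → ‖v₂ - w₂‖ ≤ r₂ →
      dist (switch n k y • v₁ + (1 - switch n k y) • v₂)
        (switch n k y • w₁ + (1 - switch n k y) • w₂)
        ≤ switch n k y * r₁ + (1 - switch n k y) * r₂ := fun k y v₁ v₂ w₁ w₂ r₁ r₂ h₁ h₂ => by
    obtain ⟨h0, h1⟩ := switch_mem_Icc k y
    rw [dist_eq_norm, show switch n k y • v₁ + (1 - switch n k y) • v₂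
      - (switch n k y • w₁ + (1 - switch n k y) • w₂)
      = switch n k y • (v₁ - w₁) + (1 - switch n k y) • (v₂ - w₂) by module]
    refine (norm_add_le _ _).trans (add_le_add ?_ ?_)
    · rw [norm_smul, Real.norm_of_nonneg h0]; gcongr
    · rw [norm_smul, Real.norm_of_nonneg (by linarith)]
      exact mul_le_mul_of_nonneg_left h₂ (by linarith)
  obtain ⟨X, hXL, hX0, hX⟩ := exists_solution_of_approximation (isClosed_field hb₁ hb₂)
    (convex_field hc₁ hc₂)
    (f := fun k x => switch n k x • b₁ x α₁ + (1 - switch n k x) • b₂ x α₂) (M := M)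
    (fun k => ⟨_, lipschitzWith_convexCombination hK₁ hK₂ (lipschitzWith_switch n k)
      (switch_mem_Icc k) hM₁' hM₂'⟩)
    (fun k x => by
      have := hdist k x (b₁ x α₁) (b₂ x α₂) 0 0 M M (by simpa using hM₁' x) (by simpa using hM₂' x)
      simpa [← add_mul] using this)
    (fun x δ hδ => by
      obtain ⟨η, hη, hev⟩ := exists_switch_mem_field (b₁ := b₁) (b₂ := b₂) α₁ α₂ x
      -- The second bound keeps each frozen-control field within δ of its value at x; the same
      -- weights then give an element of the field at x.
      refine ⟨min η (δ / (K₁ + K₂ + 1)), by positivity, ?_⟩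
      filter_upwards [hev] with k hk y hy
      refine Metric.mem_cthickening_of_dist_le _ _ _ _ (hk y (hy.trans_le (min_le_left _ _))) ?_
      obtain ⟨h0, h1⟩ := switch_mem_Icc k y
      have hyx : (K₁ + K₂ + 1) * dist y x ≤ δ :=
        (le_div_iff₀' (by positivity)).1 (hy.le.trans (min_le_right _ _))
      have e₁ : K₁ * dist y x ≤ δ := le_trans (by gcongr; linarith [K₂.2]) hyx
      have e₂ : K₂ * dist y x ≤ δ := le_trans (by gcongr; linarith [K₁.2]) hyx
      have := hdist k y _ _ _ _ δ δ
        ((dist_eq_norm (b₁ y α₁) (b₁ x α₁) ▸ hK₁.dist_le_mul y x).trans e₁)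
        ((dist_eq_norm (b₂ y α₂) (b₂ x α₂) ▸ hK₂.dist_le_mul y x).trans e₂)
      simpa [← add_mul] using this) x₀
  exact ⟨X, ⟨M, hXL.lipschitzOnWith⟩, hX0, hX⟩

/-! ### Control representation and tangency -/

section Control

variable {b₁ : Space n → A₁ → Space n} {b₂ : Space n → A₂ → Space n}

theorem generated_velocity_of_pos {X : ℝ → Space n} {a : ℝ → ControlSet A₁ A₂} {t : ℝ}
    (h : 0 < X t (Fin.last n)) :
    {s | X s ∈ Omega₁ n}.indicator (fun s => b₁ (X s) (a s).1) t
        + {s | X s ∈ Omega₂ n}.indicator (fun s => b₂ (X s) (a s).2.1) t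
        + {s | X s ∈ Hyper n}.indicator (fun s => bH b₁ b₂ (X s) (a s)) t = b₁ (X t) (a t).1 := by
  simp [indicator, Omega₁, Omega₂, Hyper, h, h.ne', not_lt_of_gt h]

theorem generated_velocity_of_neg {X : ℝ → Space n} {a : ℝ → ControlSet A₁ A₂} {t : ℝ}
    (h : X t (Fin.last n) < 0) :
    {s | X s ∈ Omega₁ n}.indicator (fun s => b₁ (X s) (a s).1) t
        + {s | X s ∈ Omega₂ n}.indicator (fun s => b₂ (X s) (a s).2.1) t
        + {s | X s ∈ Hyper n}.indicator (fun s => bH b₁ b₂ (X s) (a s)) t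
      = b₂ (X t) (a t).2.1 := by
  simp [indicator, Omega₁, Omega₂, Hyper, h, h.ne, not_lt_of_gt h]

theorem generated_velocity_of_eq_zero {X : ℝ → Space n} {a : ℝ → ControlSet A₁ A₂} {t : ℝ}
    (h : X t (Fin.last n) = 0) :
    {s | X s ∈ Omega₁ n}.indicator (fun s => b₁ (X s) (a s).1) t
        + {s | X s ∈ Omega₂ n}.indicator (fun s => b₂ (X s) (a s).2.1) t
        + {s | X s ∈ Hyper n}.indicator (fun s => bH b₁ b₂ (X s) (a s)) t
      = bH b₁ b₂ (X t) (a t) := by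
  simp [indicator, Omega₁, Omega₂, Hyper, h]

theorem IsGeneratedBy.inner_bH_eN_eq_zero {X : ℝ → Space n} {a : ℝ → ControlSet A₁ A₂}
    (hX : IsGeneratedBy b₁ b₂ X a) :
    ∀ᵐ t ∂(volume.restrict (Ioi (0 : ℝ))),
      X t ∈ Hyper n → inner ℝ (bH b₁ b₂ (X t) (a t)) (eN n) = 0 := by
  filter_upwards [hX, ae_restrict_of_ae
    (ae_eq_zero_of_hasDerivAt_of_eq_zero (f := fun t => X t (Fin.last n)))] with t hd h0 ht
  rw [generated_velocity_of_eq_zero ht] at hd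
  have hcoord := h0 ht _ ((EuclideanSpace.proj (𝕜 := ℝ) (Fin.last n)).hasFDerivAt.comp_hasDerivAt t hd)
  simpa [eN, EuclideanSpace.inner_single_right] using hcoord

theorem IsTrajectory.exists_control
    [MetricSpace A₁] [CompactSpace A₁] [Nonempty A₁] [MeasurableSpace A₁] [BorelSpace A₁]
    [MetricSpace A₂] [CompactSpace A₂] [Nonempty A₂] [MeasurableSpace A₂] [BorelSpace A₂]
    {l₁ : Space n → A₁ → ℝ} {l₂ : Space n → A₂ → ℝ}
    (hb₁ : LipschitzDynamic b₁) (hb₂ : LipschitzDynamic b₂)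
    (hc₁ : ClosedConvexImages b₁ l₁) (hc₂ : ClosedConvexImages b₂ l₂)
    {x₀ : Space n} {X : ℝ → Space n} (hX : IsTrajectory b₁ b₂ x₀ X) :
    ∃ a : ℝ → ControlSet A₁ A₂, IsControl a ∧ IsGeneratedBy b₁ b₂ X a := by
  obtain ⟨K, hK⟩ := hX.lipschitz
  -- X is controlled only on [0, ∞); `max t 0` gives a continuous curve on the whole line with the
  -- same values there.
  have hZ : Continuous fun t : ℝ => X (max t 0) :=
    hK.continuousOn.comp_continuous (by fun_prop) fun t => le_max_right t 0
  have hN : Measurable fun t : ℝ => X (max t 0) (Fin.last n) :=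
    ((EuclideanSpace.proj (𝕜 := ℝ) (Fin.last n)).continuous.comp hZ).measurable
  obtain ⟨a₁, ha₁, hsel₁⟩ := exists_measurable_implicit_selection
    (g := fun t α => b₁ (X (max t 0)) α) (y := deriv X)
    (fun α => (hb₁.continuous.comp (hZ.prodMk continuous_const)).measurable)
    (fun t => hb₁.continuous_control _) (measurable_deriv X)
  obtain ⟨a₂, ha₂, hsel₂⟩ := exists_measurable_implicit_selection
    (g := fun t α => b₂ (X (max t 0)) α) (y := deriv X)
    (fun α => (hb₂.continuous.comp (hZ.prodMk continuous_const)).measurable)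
    (fun t => hb₂.continuous_control _) (measurable_deriv X)
  obtain ⟨a₃, ha₃, hsel₃⟩ := exists_measurable_implicit_selection
    (g := fun t (α : ControlSet A₁ A₂) => bH b₁ b₂ (X (max t 0)) α) (y := deriv X)
    (fun α => ((continuous_bH hb₁ hb₂).comp (hZ.prodMk continuous_const)).measurable)
    (fun t => (continuous_bH hb₁ hb₂).comp (Continuous.prodMk_right _)) (measurable_deriv X)
  -- Only the component active on the current side matters; `a₃` fills in the others.
  refine ⟨fun t => if 0 < X (max t 0) (Fin.last n) then (a₁ t, (a₃ t).2)
    else if X (max t 0) (Fin.last n) < 0 then ((a₃ t).1, a₂ t, (a₃ t).2.2) else a₃ t, ?_, ?_⟩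
  · refine Measurable.aemeasurable (Measurable.ite (measurableSet_lt measurable_const hN) ?_
      (Measurable.ite (measurableSet_lt hN measurable_const) ?_ ha₃))
    · fun_prop
    · fun_prop
  filter_upwards [hX.inclusion, ae_restrict_mem measurableSet_Ioi] with t ⟨v, hv, hd⟩ ht
  have hmax : max t 0 = t := max_eq_left (le_of_lt ht)
  convert hd using 1
  rcases lt_trichotomy (X t (Fin.last n)) 0 with h | h | h
  · rw [field_of_neg h] at hv
    have := hsel₂ t (by rwa [hmax, hd.deriv])
    rw [hmax, hd.deriv] at this
    rw [generated_velocity_of_neg h]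
    simp [hmax, h, not_lt_of_gt h, this]
  · have := hsel₃ t (by rw [hmax, hd.deriv]; exact field_subset_range_bH hb₁ hb₂ hc₁ hc₂ h hv)
    rw [hmax, hd.deriv] at this
    rw [generated_velocity_of_eq_zero h]
    simp [hmax, h, this]
  · rw [field_of_pos h] at hv
    have := hsel₁ t (by rwa [hmax, hd.deriv])
    rw [hmax, hd.deriv] at this
    rw [generated_velocity_of_pos h]
    simp [hmax, h, this]

end Control

end TwoDomain

theorem theorem2p1 {n : ℕ} {A₁ A₂ : Type*}
    [MetricSpace A₁] [CompactSpace A₁] [Nonempty A₁] [MeasurableSpace A₁] [BorelSpace A₁]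
    [MetricSpace A₂] [CompactSpace A₂] [Nonempty A₂] [MeasurableSpace A₂] [BorelSpace A₂]
    (b₁ : TwoDomain.Space n → A₁ → TwoDomain.Space n)
    (b₂ : TwoDomain.Space n → A₂ → TwoDomain.Space n)
    (l₁ : TwoDomain.Space n → A₁ → ℝ) (l₂ : TwoDomain.Space n → A₂ → ℝ)
    (hb₁ : TwoDomain.LipschitzDynamic b₁) (hb₂ : TwoDomain.LipschitzDynamic b₂)
    (hl₁ : TwoDomain.BoundedCost l₁) (hl₂ : TwoDomain.BoundedCost l₂)
    (hc₁ : TwoDomain.ClosedConvexImages b₁ l₁) (hc₂ : TwoDomain.ClosedConvexImages b₂ l₂) :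
    (∀ x₀ : TwoDomain.Space n, ∃ X : ℝ → TwoDomain.Space n,
      TwoDomain.IsTrajectory b₁ b₂ x₀ X) ∧
    (∀ (x₀ : TwoDomain.Space n) (X : ℝ → TwoDomain.Space n),
      TwoDomain.IsTrajectory b₁ b₂ x₀ X →
      (∃ a : ℝ → TwoDomain.ControlSet A₁ A₂,
        TwoDomain.IsControl a ∧ TwoDomain.IsGeneratedBy b₁ b₂ X a) ∧
      (∀ a : ℝ → TwoDomain.ControlSet A₁ A₂,
        TwoDomain.IsControl a → TwoDomain.IsGeneratedBy b₁ b₂ X a →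
        ∀ᵐ t ∂(MeasureTheory.volume.restrict (Set.Ioi (0 : ℝ))),
          X t ∈ TwoDomain.Hyper n →
            inner ℝ (TwoDomain.bH b₁ b₂ (X t) (a t)) (TwoDomain.eN n) = 0)) :=
  ⟨fun x₀ => TwoDomain.exists_isTrajectory hb₁ hb₂ hc₁ hc₂ x₀, fun _ _ hX =>
    ⟨hX.exists_control hb₁ hb₂ hc₁ hc₂, fun _ _ ha => ha.inner_bH_eN_eq_zero⟩⟩
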